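/- Let $K$ be plain Kolmogorov complexity of binary strings with respect to a fixed optimal partial computable decompressor, and let the complexity of a tuple of strings be the complexity of a fixed computable encoding of the tuple by a string. Let $m\in\mathbb{N}$, and for a non-empty $I\subset\{1,\dots,m\}$ and a tuple $x=\langle x_1,\dots,x_m\rangle$ let $x_I$ denote the sub-tuple of all $x_i$ with $i\in I$; for $S\subset\mathbb{R}^m$ let $S_I\subset\mathbb{R}^{\#I}$ denote the projection of $S$ onto the coordinates in $I$. Let $\mathcal{I}$ and $\mathcal{J}$ be two disjoint families of non-empty subsets of $\{1,\dots,m\}$, where $\mathcal{I}$ is non-empty, and let $\lambda_I$ ($I\in\mathcal{I}$) and $\mu_J$ ($J\in\mathcal{J}$) be positive reals. Suppose that $$\sum_{I\in\mathcal{I}}\lambda_I K(x_I)\le\sum_{J\in\mathcal{J}}\mu_J K(x_J)+O(\log n)$$ holds for all $n\ge 2$ and all $m$-tuples $\langle x_1,\dots,x_m\rangle$ of $n$-bit strings, with a constant in $O(\log n)$ that does not depend on $n$ and $x_1,\dots,x_m$. Then for every set $S\subset\mathbb{R}^m$ and all non-negative reals $a_I$ ($I\in\mathcal{I}$) such that $$\sum_{J\in\mathcal{J}}\mu_J\dim_p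 S_J\le\sum_{I\in\mathcal{I}}\lambda_I a_I,$$ where $\dim_p$ is packing dimension, there exists a splitting $S=\bigcup_{I\in\mathcal{I}}S^I$ such that for every $I\in\mathcal{I}$ the projection $S^I_I$ of $S^I$ onto the coordinates in $I$ satisfies $$\dim_H S^I_I\le a_I,$$ where $\dim_H$ is Hausdorff dimension. -/

import Mathlib

open scoped ENNReal NNReal

namespace KolmDim

/-! ### Kolmogorov complexity of binary strings and of tuples of binary strings -/

/-- Plain Kolmogorov complexity of the string `x` for the decompressor (programming language) `D`:
the minimal length of a program `p` with `D p = x`.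
(An optimal decompressor, see below, has a program for every string, so that the set is nonempty.) -/
noncomputable def complexity (D : List Bool →. List Bool) (x : List Bool) : ℕ :=
  sInf {k | ∃ p : List Bool, x ∈ D p ∧ p.length = k}

/-- `D` is an optimal decompressor: it is partial computable, and for every partial computable `D'`
there is a constant `c` such that whatever `D'` produces from a program `p` is produced by `D` from
a program that is longer than `p` by at most `c`. -/
def IsOptimal (D : List Bool →. List Bool) : Prop :=
  Partrec D ∧ ∀ D' : List Bool →. List Bool, Partrec D' →
    ∃ c : ℕ, ∀ p x : List Bool, x ∈ D' p → ∃ q : List Bool, x ∈ D q ∧ q.length ≤ p.length + c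

/-- A computable encoding of finite tuples of strings by strings: in every string of the tuple each
bit is doubled, and the string is followed by the delimiter `01`. -/
def tupleCode (l : List (List Bool)) : List Bool :=
  l.flatMap fun x => (x.flatMap fun b => [b, b]) ++ [false, true]

/-- The sub-tuple `x_I` of `x = (x_1, …, x_m)`: all `x_i` with `i ∈ I`, in increasing order of `i`. -/
def subtuple {m : ℕ} (x : Fin m → List Bool) (I : Finset (Fin m)) : List (List Bool) :=
  ((List.finRange m).filter fun i => i ∈ I).map x

/-- The Kolmogorov complexity of the sub-tuple `x_I`. -/
noncomputable def tupleComplexity (D : List Bool →. List Bool) {m : ℕ} (x : Fin m → List Bool)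
    (I : Finset (Fin m)) : ℕ :=
  complexity D (tupleCode (subtuple x I))

/-- The linear inequality
`∑_{I ∈ 𝓘} lam_I K(x_I) ≤ ∑_{J ∈ 𝓙} mu_J K(x_J) + O(log n)` is true for all `m`-tuples of `n`-bit
strings, the constant in `O(log n)` depending neither on `n` nor on the strings.
As `log 1 = 0`, the bound is read for `n ≥ 2`. -/
def ComplexityInequality (D : List Bool →. List Bool) {m : ℕ} (𝓘 𝓙 : Finset (Finset (Fin m)))
    (lam mu : Finset (Fin m) → ℝ) : Prop :=
  ∃ C : ℝ, ∀ n : ℕ, 2 ≤ n → ∀ x : Fin m → List Bool, (∀ i, (x i).length = n) →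
    ∑ I ∈ 𝓘, lam I * (tupleComplexity D x I : ℝ) ≤
      ∑ J ∈ 𝓙, mu J * (tupleComplexity D x J : ℝ) + C * Real.log n

/-! ### Packing dimension -/

section Packing

variable {X : Type*} [PseudoMetricSpace X]

/-- `P` is a `δ`-packing of `E`: a countable family of pairwise disjoint closed balls with centres
in `E` and radii in `(0, δ]`; a ball is given by its centre and radius. -/
def IsPacking (E : Set X) (δ : ℝ) (P : Set (X × ℝ)) : Prop :=
  P.Countable ∧ (∀ p ∈ P, p.1 ∈ E ∧ 0 < p.2 ∧ p.2 ≤ δ) ∧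
    P.PairwiseDisjoint fun p => Metric.closedBall p.1 p.2

/-- `P^s_δ(E)`: the supremum of `∑ (2 r_i)^s` over all `δ`-packings of `E`. -/
noncomputable def packingSup (s : ℝ≥0) (δ : ℝ) (E : Set X) : ℝ≥0∞ :=
  ⨆ (P : Set (X × ℝ)) (_ : IsPacking E δ P), ∑' p : P, ENNReal.ofReal (2 * p.1.2) ^ (s : ℝ)

/-- The packing premeasure `P^s_0(E) = lim_{δ → 0} P^s_δ(E)`; the limit is the infimum since
`P^s_δ(E)` is monotone in `δ`. -/
noncomputable def packingPremeasure (s : ℝ≥0) (E : Set X) : ℝ≥0∞ :=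
  ⨅ (δ : ℝ) (_ : 0 < δ), packingSup s δ E

/-- The `s`-dimensional packing (outer) measure: the infimum of `∑ P^s_0(E_i)` over all countable
covers `E ⊆ ⋃ E_i`. -/
noncomputable def packingMeasure (s : ℝ≥0) (E : Set X) : ℝ≥0∞ :=
  ⨅ (F : ℕ → Set X) (_ : E ⊆ ⋃ i, F i), ∑' i, packingPremeasure s (F i)

/-- The packing dimension: the infimum of all `s ≥ 0` with `P^s(E) = 0`. -/
noncomputable def dimP (E : Set X) : ℝ≥0∞ :=
  ⨅ (s : ℝ≥0) (_ : packingMeasure s E = 0), (s : ℝ≥0∞)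

end Packing

/-! ### Coordinate projections -/

/-- The projection of `ℝ^m` onto the coordinates in `I`. -/
noncomputable def proj {m : ℕ} (I : Finset (Fin m)) (x : EuclideanSpace ℝ (Fin m)) :
    EuclideanSpace ℝ I :=
  WithLp.toLp 2 fun i : I => x i

end KolmDim

/-!
# Complexity inequalities and splittings by dimension

The proof passes through a statement about finite sets, so that no complexity relative to an oracle
is needed.

*Finite form* (`exists_splitting_finset`). Let `A` be a set of `m`-tuples of `n`-bit strings whose
projections to the coordinates in `J` have at most `2 ^ (n * p J / N)` elements. If
`∑ mu J * p J < ∑ lam I * w I` and `n` is large, then `A` splits into parts `A I`, whose projections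
to the coordinates in `I` have at most `2 ^ (n * w I / N)` elements. Otherwise an exhaustive search
finds, from `n` alone, a set without such a splitting (`exists_simple_uncoverable`). In that set
`K(x_J) ≤ n * p J / N + O(log n)`, because `x_J` is determined by `n` and its number in a list. By
the complexity inequality `K(x_I) < n * w I / N` for some `I`, and there are few strings of such
complexity: that is a splitting, a contradiction.

*Passage to dimensions* (`exists_splitting_of_lt`). Packing dimension below `d` means that the set
is a countable union of sets that meet at most `2 ^ (n * d)` dyadic cubes of side `2⁻ⁿ`, for all
large `n` (`exists_packingSup_le_one`, `card_dyadicCell_le`). On each piece the finite form is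
applied to the set of the dyadic cubes of level `n`, for each large `n`. A point of the piece goes
to the part `I` if its cube does so for infinitely many `n`; such an upper limit of sets has
Hausdorff dimension at most `w I / N` (`dimH_image_le_of_frequently`).

The bounds `p J / N` and `w I / N` are rational approximations from above of the packing dimensions
and of the numbers `a I`. As `N` grows, a point belongs to some part `I` for infinitely many `N`, and
taking again the upper limits of the parts gives the bounds `a I` themselves.
-/

namespace KolmDim

/-! ### Coverability of a list is primitive recursive -/

theorem primrecPred_exists_fin {α : Type*} [Primcodable α] {q : ℕ} {P : Fin q → α → Prop}
    (h : ∀ i, PrimrecPred (P i)) : PrimrecPred fun a => ∃ i, P i a := by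
  induction q with
  | zero =>
    refine PrimrecPred.of_eq (p := fun _ => False) (Primrec.primrecPred ?_) (by simp)
    simpa using Primrec.const false
  | succ q ih =>
    exact ((h 0).or (ih fun i => h i.succ)).of_eq fun a => by simp [Fin.exists_fin_succ]

theorem primrecPred_forall_fin {α : Type*} [Primcodable α] {q : ℕ} {P : Fin q → α → Prop}
    (h : ∀ i, PrimrecPred (P i)) : PrimrecPred fun a => ∀ i, P i a :=
  (primrecPred_exists_fin fun i => (h i).not).not.of_eq fun a => by simp

theorem primrecPred_exists_lt {α : Type*} [Primcodable α] {b : α → ℕ} {P : ℕ → α → Prop}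
    (hb : Primrec b) (h : PrimrecRel P) : PrimrecPred fun a => ∃ t < b a, P t a :=
  (PrimrecRel.comp (g := fun a => a) h.exists_mem_list (Primrec.list_range.comp hb)
    Primrec.id).of_eq fun a => by simp

theorem primrecPred_forall_mem {α β : Type*} [Primcodable α] [Primcodable β] {l : α → List β}
    {P : β → α → Prop} (hl : Primrec l) (h : PrimrecRel P) :
    PrimrecPred fun a => ∀ x ∈ l a, P x a :=
  PrimrecRel.comp (g := fun a => a) h.forall_mem_list hl Primrec.id

theorem primrec₂_pow : Primrec₂ ((· ^ ·) : ℕ → ℕ → ℕ) :=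
  Primrec₂.unpaired'.1 Nat.Primrec.pow

/-- The element of the list `A` that the number `c` selects at position `p`: the index is the `p`-th
digit of `c` in base `A.length`. In this way numbers code functions from positions to `A`. -/
def sel {α : Type*} (A : List α) (c p : ℕ) : Option α :=
  A[c / A.length ^ p % A.length]?

/-- Every finite sequence of numbers below `b` is the sequence of base `b` digits of a number. -/
theorem exists_digits (b : ℕ) (L : ℕ) (f : ℕ → ℕ) (hf : ∀ p, f p < b) :
    ∃ c < b ^ L, ∀ p < L, c / b ^ p % b = f p := by
  induction L generalizing f with
  | zero => exact ⟨0, by simp, by simp⟩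
  | succ L ih =>
    obtain ⟨c, hc, hcp⟩ := ih (fun p => f (p + 1)) fun p => hf _
    have hb : 0 < b := (Nat.zero_le _).trans_lt (hf 0)
    refine ⟨f 0 + b * c, ?_, fun p hp => ?_⟩
    · calc f 0 + b * c < b + b * c := by have := hf 0; omega
        _ = b * (c + 1) := by ring
        _ ≤ b * b ^ L := Nat.mul_le_mul_left _ hc
        _ = b ^ (L + 1) := by ring
    · cases p with
      | zero => simp [Nat.mod_eq_of_lt (hf 0)]
      | succ p =>
        rw [pow_succ', ← Nat.div_div_eq_div_mul, Nat.add_mul_div_left _ _ hb,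
          Nat.div_eq_of_lt (hf 0), zero_add]
        exact hcp p (by omega)

theorem exists_sel {α : Type*} {A : List α} (h : ℕ → α) (hh : ∀ p, h p ∈ A) (L : ℕ) :
    ∃ c < A.length ^ L, ∀ p < L, sel A c p = some (h p) := by
  choose k hk hkh using fun p => List.getElem_of_mem (hh p)
  obtain ⟨c, hc, hcp⟩ := exists_digits A.length L k hk
  exact ⟨c, hc, fun p hp => by rw [sel, hcp p hp, List.getElem?_eq_getElem (hk p), hkh p]⟩

theorem primrec_sel {α : Type*} [Primcodable α] :
    Primrec fun a : (List α × ℕ) × ℕ => sel a.1.1 a.1.2 a.2 := by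
  have hl : Primrec fun a : (List α × ℕ) × ℕ => a.1.1.length :=
    Primrec.list_length.comp (Primrec.fst.comp Primrec.fst)
  exact Primrec.list_getElem?.comp (Primrec.fst.comp Primrec.fst)
    (Primrec.nat_mod.comp (Primrec.nat_div.comp (Primrec.snd.comp Primrec.fst)
      (primrec₂_pow.comp hl Primrec.snd)) hl)

/-- The values of `f` at the elements of `A` that `c` selects at the first `M` positions
`≡ i (mod q)` include the value `f x`. -/
def Hits {α : Type*} (f : α → List Bool) (q i M : ℕ) (A : List α) (c : ℕ) (x : α) : Prop :=
  ∃ t < M, (sel A c (t * q + i)).map f = some (f x)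

theorem primrecPred_hits {α β : Type*} [Primcodable α] [Primcodable β] {f : α → List Bool}
    (hf : Primrec f) (q i : ℕ) {M c : β → ℕ} {A : β → List α} {x : β → α}
    (hM : Primrec M) (hA : Primrec A) (hc : Primrec c) (hx : Primrec x) :
    PrimrecPred fun b => Hits f q i (M b) (A b) (c b) (x b) := by
  refine primrecPred_exists_lt hM (P := fun t b => _) ?_
  refine Primrec.eq.comp (Primrec.option_map (f := fun a : ℕ × β =>
      sel (A a.2) (c a.2) (a.1 * q + i)) (g := fun _ y => f y) ?_ (hf.comp Primrec.snd).to₂)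
    (Primrec.option_some.comp (hf.comp (hx.comp Primrec.snd)))
  exact primrec_sel.comp (Primrec.pair (Primrec.pair (hA.comp Primrec.snd) (hc.comp Primrec.snd))
    (Primrec.nat_add.comp (Primrec.nat_mul.comp Primrec.fst (Primrec.const q)) (Primrec.const i)))

/-- The set `A` is covered by the conditions `φ i x ∈ B i` for some finite sets `B i` of
at most `M i` strings. -/
def Coverable {α ι : Type*} (φ : ι → α → List Bool) (M : ι → ℕ) (A : Set α) : Prop :=
  ∃ B : ι → Finset (List Bool), (∀ i, (B i).card ≤ M i) ∧ ∀ x ∈ A, ∃ i, φ i x ∈ B i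

/-- The sets `B i` are enumerated by one number `c`, at positions `≡ i (mod q)`; its bound makes the
existence of a cover decidable by a bounded search. -/
theorem exists_hits {α : Type*} {q : ℕ} {f : Fin q → α → List Bool} {M : Fin q → ℕ} {U : ℕ}
    (hU : ∀ i, M i ≤ U) {A : List α} (hA : A ≠ []) (B : Fin q → Finset (List Bool))
    (hB : ∀ i, (B i).card ≤ M i) :
    ∃ c < A.length ^ (q * U), ∀ i, ∀ x ∈ A, f i x ∈ B i → Hits (f i) q i (M i) A c x := by
  classical
  obtain ⟨x₀, hx₀⟩ := List.exists_mem_of_ne_nil A hA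
  -- The `t`-th string of `B i` is attained at the element `e i t` of `A` if it is attained at all.
  have key : ∀ (i : Fin q) (t : ℕ), ∃ y ∈ A, ∀ x ∈ A, (B i).toList[t]? = some (f i x) →
      f i y = f i x := by
    intro i t
    by_cases h : ∃ x ∈ A, (B i).toList[t]? = some (f i x)
    · obtain ⟨x, hx, hxt⟩ := h
      exact ⟨x, hx, fun x' _ hx' => by rw [hxt] at hx'; exact Option.some.inj hx'⟩
    · exact ⟨x₀, hx₀, fun x hx hxt => (h ⟨x, hx, hxt⟩).elim⟩
  choose e heA he using key
  obtain ⟨c, hc, hsel⟩ := exists_sel (A := A)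
    (fun p => if h : p % q < q then e ⟨p % q, h⟩ (p / q) else x₀)
    (fun p => by split_ifs <;> simp [heA, hx₀]) (q * U)
  refine ⟨c, hc, fun i x hx hxi => ?_⟩
  obtain ⟨t, ht, htx⟩ := List.getElem_of_mem (Finset.mem_toList.2 hxi)
  have htM : t < M i := ht.trans_le (by simpa using hB i)
  refine ⟨t, htM, ?_⟩
  have hp : t * q + i < q * U := by
    have h1 : (t + 1) * q ≤ U * q := Nat.mul_le_mul_right _ (htM.trans_le (hU i))
    have := i.2
    nlinarith
  have hmod : (t * q + i) % q = i := by
    rw [Nat.add_comm, Nat.add_mul_mod_self_right, Nat.mod_eq_of_lt i.2]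
  have hdiv : (t * q + i) / q = t := by
    rw [Nat.add_comm, Nat.add_mul_div_right _ _ (Nat.zero_lt_of_lt i.2), Nat.div_eq_of_lt i.2,
      zero_add]
  rw [hsel _ hp]
  simp only [hmod, hdiv, i.2, dite_true, Fin.eta, Option.map_some]
  rw [he i t x hx]
  rw [List.getElem?_eq_getElem ht, htx]

theorem coverable_of_hits {α : Type*} {q : ℕ} {f : Fin q → α → List Bool} {M : Fin q → ℕ}
    {A : List α} {c : ℕ} (h : ∀ x ∈ A, ∃ i, Hits (f i) q i (M i) A c x) :
    Coverable f M {x | x ∈ A} := by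
  classical
  refine ⟨fun i => ((Finset.range (M i)).image
    fun t => ((sel A c (t * q + i)).map (f i)).getD []), fun i => ?_, fun x hx => ?_⟩
  · exact Finset.card_image_le.trans (by simp)
  · obtain ⟨i, t, ht, hti⟩ := h x hx
    exact ⟨i, Finset.mem_image.2 ⟨t, Finset.mem_range.2 ht, by rw [hti]; rfl⟩⟩

/-- The `+ 1` admits the code `0` for the empty list. -/
theorem coverable_iff {α : Type*} {q : ℕ} {f : Fin q → α → List Bool} {M : Fin q → ℕ} {U : ℕ}
    (hU : ∀ i, M i ≤ U) (A : List α) :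
    Coverable f M {x | x ∈ A} ↔
      ∃ c < A.length ^ (q * U) + 1, ∀ x ∈ A, ∃ i, Hits (f i) q i (M i) A c x := by
  constructor
  · rintro ⟨B, hB, hA⟩
    rcases eq_or_ne A [] with rfl | hne
    · exact ⟨0, by simp, by simp⟩
    · obtain ⟨c, hc, hch⟩ := exists_hits hU hne B hB
      exact ⟨c, hc.trans (Nat.lt_succ_self _), fun x hx =>
        (hA x hx).imp fun i hi => hch i x hx hi⟩
  · rintro ⟨c, -, h⟩
    exact coverable_of_hits h

/-! ### Complexity bounds from decompressors -/

theorem complexity_le {D : List Bool →. List Bool} {p x : List Bool} (h : x ∈ D p) :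
    complexity D x ≤ p.length :=
  Nat.sInf_le ⟨p, h, rfl⟩

/-- The natural number with the binary digits `l`, the least significant digit first. -/
def binValue (l : List Bool) : ℕ :=
  l.foldr (fun b n => 2 * n + cond b 1 0) 0

theorem binValue_bits (n : ℕ) : binValue n.bits = n := by
  induction n using Nat.binaryRec' with
  | zero => simp [binValue]
  | bit b n h ih =>
    rw [Nat.bits_append_bit n b h]
    change 2 * binValue n.bits + cond b 1 0 = _
    rw [ih]
    cases b <;> simp [Nat.bit]

theorem primrec_binValue : Primrec binValue := by
  refine Primrec.list_foldr (h := fun _ (a : Bool × ℕ) => 2 * a.2 + cond a.1 1 0)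
    Primrec.id (Primrec.const 0) ?_
  refine Primrec.nat_add.comp (Primrec.nat_mul.comp (Primrec.const 2)
    (Primrec.snd.comp Primrec.snd)) ?_
  exact Primrec.cond (Primrec.fst.comp Primrec.snd) (Primrec.const 1) (Primrec.const 0)

theorem exists_complexity_le_size {D : List Bool →. List Bool} (hD : IsOptimal D)
    {F : ℕ →. List Bool} (hF : Partrec F) :
    ∃ c : ℕ, ∀ N x, x ∈ F N → complexity D x ≤ N.size + c := by
  obtain ⟨c, hc⟩ := hD.2 (fun p => F (binValue p)) (hF.comp primrec_binValue.to_comp)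
  refine ⟨c, fun N x hx => ?_⟩
  obtain ⟨q, hq, hle⟩ := hc N.bits x (by rwa [binValue_bits])
  rw [Nat.size_eq_bits_len] at hle
  exact (complexity_le hq).trans hle

/-! ### The search for an uncoverable list of tuples -/

section Search

variable {α : Type*} [Primcodable α] {q r : ℕ} (φ : Fin q → α → List Bool)
  (ψ : Fin r → α → List Bool) (M : Fin q → ℕ → ℕ) (U : ℕ → ℕ) (v : Fin r → ℕ → ℕ)
  (V : ℕ → α → Prop)

/-- `w = (A, c)` certifies that `A` is an uncoverable list of valid elements: the number `c`
enumerates the at most `2 ^ v j n` values of every `ψ j` on `A`, and no number below the bound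
enumerates a cover. -/
def IsWitness (n : ℕ) (w : List α × ℕ) : Prop :=
  ((∀ x ∈ w.1, V n x) ∧ ∀ j : Fin r, ∀ x ∈ w.1, Hits (ψ j) r j (2 ^ v j n) w.1 w.2 x) ∧
    ¬ ∃ c < w.1.length ^ (q * U n) + 1, ∀ x ∈ w.1, ∃ i : Fin q, Hits (φ i) q i (M i n) w.1 c x

variable {φ ψ M U v V}

theorem primrecRel_isWitness (hφ : ∀ i, Primrec (φ i)) (hψ : ∀ j, Primrec (ψ j))
    (hM : ∀ i, Primrec (M i)) (hU : Primrec U) (hv : ∀ j, Primrec (v j)) (hV : PrimrecRel V) :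
    PrimrecRel (IsWitness φ ψ M U v V) := by
  have hA : Primrec fun a : ℕ × List α × ℕ => a.2.1 := Primrec.fst.comp Primrec.snd
  refine PrimrecPred.and (PrimrecPred.and ?_ ?_) (PrimrecPred.not ?_)
  · exact primrecPred_forall_mem (P := fun x (a : ℕ × List α × ℕ) => V a.1 x) hA
      (hV.comp (Primrec.fst.comp Primrec.snd) Primrec.fst)
  · refine primrecPred_forall_fin fun j => primrecPred_forall_mem
      (P := fun x (a : ℕ × List α × ℕ) => Hits (ψ j) r j (2 ^ v j a.1) a.2.1 a.2.2 x) hA ?_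
    exact primrecPred_hits (hψ j) r j
      (primrec₂_pow.comp (Primrec.const 2) ((hv j).comp (Primrec.fst.comp Primrec.snd)))
      (hA.comp Primrec.snd) (Primrec.snd.comp (Primrec.snd.comp Primrec.snd)) Primrec.fst
  · refine primrecPred_exists_lt (P := fun c (a : ℕ × List α × ℕ) =>
      ∀ x ∈ a.2.1, ∃ i : Fin q, Hits (φ i) q i (M i a.1) a.2.1 c x) ?_ ?_
    · exact Primrec.succ.comp (primrec₂_pow.comp (Primrec.list_length.comp hA)
        (Primrec.nat_mul.comp (Primrec.const q) (hU.comp Primrec.fst)))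
    · refine primrecPred_forall_mem (P := fun x (b : ℕ × ℕ × List α × ℕ) =>
        ∃ i : Fin q, Hits (φ i) q i (M i b.2.1) b.2.2.1 b.1 x) (hA.comp Primrec.snd) ?_
      refine primrecPred_exists_fin fun i => ?_
      exact primrecPred_hits (hφ i) q i
        ((hM i).comp (Primrec.fst.comp (Primrec.snd.comp Primrec.snd)))
        (hA.comp (Primrec.snd.comp Primrec.snd)) (Primrec.fst.comp Primrec.snd) Primrec.fst

/-- Searching for a pair that satisfies a primitive recursive condition is partial recursive. -/
theorem exists_partrec_search {β : Type*} [Primcodable β] {W : ℕ → β → Prop} (hW : PrimrecRel W) :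
    ∃ s : ℕ →. β, Partrec s ∧ (∀ n, ∀ w ∈ s n, W n w) ∧ ∀ n, (∃ w, W n w) → (s n).Dom := by
  classical
  let f : ℕ → ℕ → Option β := fun n k =>
    (Encodable.decode (α := β) k).bind fun w => Option.guard (W n) w
  have hf : Primrec₂ f := by
    refine Primrec.option_bind (Primrec.decode.comp Primrec.snd) ?_
    exact Primrec.option_guard (p := fun (a : (ℕ × ℕ) × β) w => W a.1.1 w)
      (hW.comp (Primrec.fst.comp (Primrec.fst.comp Primrec.fst)) Primrec.snd) Primrec.snd
  refine ⟨fun n => Nat.rfindOpt (f n), Partrec.rfindOpt hf.to_comp, fun n w hw => ?_, ?_⟩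
  · obtain ⟨k, hk⟩ := Nat.rfindOpt_spec hw
    obtain ⟨w', -, hw'⟩ := Option.bind_eq_some_iff.1 hk
    obtain ⟨rfl, h⟩ := Option.guard_eq_some_iff.1 hw'
    simpa using h
  · rintro n ⟨w, hw⟩
    refine Nat.rfindOpt_dom.2 ⟨Encodable.encode w, w, ?_⟩
    simp [f, Option.guard, hw]

/-- If at some `n` there is an uncoverable set, then there is a simple one: the first one found by
an exhaustive search. It is determined by `n`, so that the values of `ψ j` on it are determined
by `n` and a number below `2 ^ v j n`. -/
theorem exists_simple_uncoverable {D : List Bool →. List Bool} (hD : IsOptimal D)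
    (hφ : ∀ i, Primrec (φ i)) (hψ : ∀ j, Primrec (ψ j))
    (hM : ∀ i, Primrec (M i)) (hU : Primrec U) (hMU : ∀ i n, M i n ≤ U n)
    (hv : ∀ j, Primrec (v j)) (hvm : ∀ j, Monotone (v j)) (hV : PrimrecRel V) :
    ∃ C : ℕ, ∀ (n : ℕ) (A : Finset α), (∀ x ∈ A, V n x) →
      (∀ j, (A.image (ψ j)).card ≤ 2 ^ v j n) → ¬ Coverable φ (fun i => M i n) (A : Set α) →
      ∃ A' : Set α, (∀ x ∈ A', V n x) ∧ ¬ Coverable φ (fun i => M i n) A' ∧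
        ∀ x ∈ A', ∀ j, complexity D (ψ j x) ≤ v j n + (n + 1).size + C := by
  classical
  obtain ⟨s, hs, hsW, hsdom⟩ :=
    exists_partrec_search (primrecRel_isWitness hφ hψ hM hU hv hV)
  -- The pair of `n` and `k < 2 ^ v j n` is coded by the number `n * 2 ^ v j n + k`.
  let d : Fin r → ℕ →. ℕ := fun j N =>
    Nat.rfind fun n => Part.some (decide (N < (n + 1) * 2 ^ v j n))
  have hvp : ∀ j, Primrec fun n => 2 ^ v j n := fun j =>
    primrec₂_pow.comp (Primrec.const 2) (hv j)
  have hd : ∀ j, Partrec (d j) := fun j => by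
    refine Partrec.rfind (p := fun N n => Part.some (decide (N < (n + 1) * 2 ^ v j n))) ?_
    refine Computable.partrec (f := fun a : ℕ × ℕ => decide (a.1 < (a.2 + 1) * 2 ^ v j a.2)) ?_
    refine (PrimrecPred.decide ?_).to_comp
    exact Primrec.nat_lt.comp Primrec.fst
      (Primrec.nat_mul.comp (Primrec.succ.comp Primrec.snd) ((hvp j).comp Primrec.snd))
  let F : Fin r → ℕ →. List Bool := fun j N =>
    (d j N).bind fun n => (s n).bind fun w =>
      ((sel w.1 w.2 (N % 2 ^ v j n * r + j)).map (ψ j) : Part (List Bool))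
  have hF : ∀ j, Partrec (F j) := fun j => by
    refine (hd j).bind (g := fun N n => (s n).bind fun w =>
      ((sel w.1 w.2 (N % 2 ^ v j n * r + j)).map (ψ j) : Part (List Bool))) ?_
    refine Partrec.bind (f := fun a : ℕ × ℕ => s a.2) (g := fun (a : ℕ × ℕ) (w : List α × ℕ) =>
      ((sel w.1 w.2 (a.1 % 2 ^ v j a.2 * r + j)).map (ψ j) : Part (List Bool)))
      (hs.comp Computable.snd) ?_
    refine Computable.ofOption (f := fun b : (ℕ × ℕ) × (List α × ℕ) =>
      (sel b.2.1 b.2.2 (b.1.1 % 2 ^ v j b.1.2 * r + j)).map (ψ j)) (Primrec.to_comp ?_)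
    refine Primrec.option_map (primrec_sel.comp (Primrec.pair Primrec.snd ?_))
      ((hψ j).comp Primrec.snd).to₂
    refine Primrec.nat_add.comp (Primrec.nat_mul.comp (Primrec.nat_mod.comp
      (Primrec.fst.comp Primrec.fst) ((hvp j).comp (Primrec.snd.comp Primrec.fst)))
      (Primrec.const r)) (Primrec.const _)
  choose c hc using fun j => exists_complexity_le_size hD (hF j)
  refine ⟨∑ j, c j, fun n A hAV hAψ hAc => ?_⟩
  have hcov := coverable_iff (f := φ) (M := fun i => M i n) (U := U n) (fun i => hMU i n)
  have hdom : (s n).Dom := by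
    refine hsdom n ?_
    have hAcov : ¬ Coverable φ (fun i => M i n) {x | x ∈ A.toList} := by simpa using hAc
    have hne : A.toList ≠ [] := by
      rintro h
      exact hAcov ⟨fun _ => ∅, by simp, by simp [h]⟩
    obtain ⟨e, -, he⟩ := exists_hits (f := ψ) (M := fun j => 2 ^ v j n) (U := ∑ j, 2 ^ v j n)
      (fun j => Finset.single_le_sum (f := fun j => 2 ^ v j n) (fun _ _ => Nat.zero_le _)
        (Finset.mem_univ j)) hne (fun j => A.image (ψ j)) hAψ
    refine ⟨(A.toList, e), ⟨fun x hx => hAV x (Finset.mem_toList.1 hx), fun j x hx =>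
      he j x hx (Finset.mem_image_of_mem _ (Finset.mem_toList.1 hx))⟩, ?_⟩
    exact fun h => hAcov ((hcov _).2 h)
  obtain ⟨⟨A', e⟩, hw⟩ := Part.dom_iff_mem.1 hdom
  obtain ⟨⟨h1, h2⟩, h3⟩ := hsW n _ hw
  refine ⟨{x | x ∈ A'}, h1, fun h => h3 ((hcov _).1 h), fun x hx j => ?_⟩
  obtain ⟨k, hk, hkx⟩ := h2 j x hx
  have hpos : 0 < 2 ^ v j n := by positivity
  have hlt : n * 2 ^ v j n + k < (n + 1) * 2 ^ v j n := by rw [add_mul, one_mul]; omega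
  have hmem : ψ j x ∈ F j (n * 2 ^ v j n + k) := by
    refine Part.mem_bind_iff.2 ⟨n, ?_, Part.mem_bind_iff.2 ⟨_, hw, ?_⟩⟩
    · refine Nat.mem_rfind.2 ⟨by simpa using hlt, fun {n'} hn' => ?_⟩
      have : (n' + 1) * 2 ^ v j n' ≤ n * 2 ^ v j n :=
        Nat.mul_le_mul hn' (Nat.pow_le_pow_right (by norm_num) (hvm j hn'.le))
      simpa using this.trans (Nat.le_add_right _ _)
    · rw [Nat.add_comm (n * _), Nat.add_mul_mod_self_right, Nat.mod_eq_of_lt hk]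
      simpa using hkx
  have hsize : (n * 2 ^ v j n + k).size ≤ v j n + (n + 1).size := by
    rw [Nat.size_le, pow_add, mul_comm (2 ^ v j n) (2 ^ _)]
    exact hlt.trans_le (Nat.mul_le_mul_right _ (Nat.lt_size_self _).le)
  have := hc j _ _ hmem
  have := Finset.single_le_sum (f := c) (fun _ _ => Nat.zero_le _) (Finset.mem_univ j)
  omega

end Search

/-! ### Counting strings of small complexity -/

theorem IsOptimal.exists_program {D : List Bool →. List Bool} (hD : IsOptimal D) (x : List Bool) :
    ∃ p, x ∈ D p ∧ p.length = complexity D x := by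
  obtain ⟨c, hc⟩ := hD.2 (fun p => Part.some p) Partrec.some
  obtain ⟨q, hq, -⟩ := hc x x (Part.mem_some x)
  exact Nat.sInf_mem (s := {k | ∃ p : List Bool, x ∈ D p ∧ p.length = k}) ⟨_, q, hq, rfl⟩

/-- The number whose binary digits are those of `l` followed by the leading digit `1`. -/
def binCode (l : List Bool) : ℕ :=
  l.foldr Nat.bit 1

theorem binCode_pos (l : List Bool) : 0 < binCode l := by
  induction l with
  | nil => exact one_pos
  | cons b l ih =>
    change 0 < Nat.bit b (binCode l)
    rw [Nat.bit_val]; omega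

theorem binCode_lt (l : List Bool) : binCode l < 2 ^ (l.length + 1) := by
  induction l with
  | nil => simp [binCode]
  | cons b l ih =>
    change Nat.bit b (binCode l) < 2 ^ (l.length + 1 + 1)
    rw [Nat.bit_val, pow_succ]
    have := b.toNat_le
    omega

theorem binCode_injective : Function.Injective binCode := by
  intro l
  induction l with
  | nil =>
    rintro (_ | ⟨b, l'⟩) h
    · rfl
    · change 1 = Nat.bit b (binCode l') at h
      have := binCode_pos l'
      rw [Nat.bit_val] at h; omega
  | cons b l ih =>
    rintro (_ | ⟨b', l'⟩) h
    · change Nat.bit b (binCode l) = 1 at h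
      have := binCode_pos l
      rw [Nat.bit_val] at h; omega
    · change Nat.bit b (binCode l) = Nat.bit b' (binCode l') at h
      rw [Nat.bit_val, Nat.bit_val] at h
      have h1 := b.toNat_le
      have h2 := b'.toNat_le
      have h3 : b = b' := by cases b <;> cases b' <;> first | rfl | (simp at h; omega)
      rw [h3, ih (show binCode l = binCode l' by omega)]

theorem IsOptimal.exists_finset_complexity_lt {D : List Bool →. List Bool} (hD : IsOptimal D)
    (u : ℕ) : ∃ B : Finset (List Bool), B.card ≤ 2 ^ u ∧ ∀ x, complexity D x < u → x ∈ B := by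
  choose p hp hpl using hD.exists_program
  have hmaps : Set.MapsTo (fun x => binCode (p x)) {x | complexity D x < u}
      (Finset.range (2 ^ u) : Set ℕ) := fun x hx => by
    have h1 := binCode_lt (p x)
    rw [hpl] at h1
    exact Finset.mem_coe.2 (Finset.mem_range.2
      (h1.trans_le (Nat.pow_le_pow_right (by norm_num) hx)))
  have hinj : Set.InjOn (fun x => binCode (p x)) {x | complexity D x < u} := fun x _ y _ h => by
    have h' := binCode_injective h
    exact Part.mem_unique (hp x) (h' ▸ hp y)
  have hfin := Set.Finite.of_injOn hmaps hinj (Finset.finite_toSet _)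
  refine ⟨hfin.toFinset, ?_, fun x hx => hfin.mem_toFinset.2 hx⟩
  simpa using Finset.card_le_card_of_injOn (s := hfin.toFinset) (t := Finset.range (2 ^ u))
    (fun x => binCode (p x)) (by simpa using hmaps) (by simpa using hinj)

/-! ### Splitting finite sets of tuples -/

theorem primrec_tupleCode : Primrec tupleCode := by
  refine Primrec.list_flatMap Primrec.id (Primrec.list_append.comp
    (Primrec.list_flatMap Primrec.snd ?_) (Primrec.const _))
  exact Primrec.list_cons.comp Primrec.snd (Primrec.list_cons.comp Primrec.snd (Primrec.const []))

theorem primrec_tupleCode_subtuple {m : ℕ} (I : Finset (Fin m)) :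
    Primrec fun x : Fin m → List Bool => tupleCode (subtuple x I) := by
  refine primrec_tupleCode.comp ?_
  unfold subtuple
  generalize (List.finRange m).filter (fun i => decide (i ∈ I)) = l
  induction l with
  | nil => exact Primrec.const []
  | cons i l ih =>
    exact Primrec.list_cons.comp (Primrec.fin_app.comp Primrec.id (Primrec.const i)) ih

theorem flatMap_double_injective :
    Function.Injective fun l : List Bool => l.flatMap fun b => [b, b] := by
  intro l
  induction l with
  | nil => rintro (_ | ⟨b, l'⟩) h <;> simp_all
  | cons b l ih =>
    rintro (_ | ⟨b', l'⟩) h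
    · simp at h
    · simp only [List.flatMap_cons, List.cons_append, List.nil_append, List.cons.injEq] at h
      rw [h.1, ih h.2.2]

theorem eq_of_tupleCode_map_eq {ι : Type*} {x y : ι → List Bool}
    (hxy : ∀ i, (x i).length = (y i).length) {l : List ι}
    (h : tupleCode (l.map x) = tupleCode (l.map y)) : ∀ i ∈ l, x i = y i := by
  induction l with
  | nil => simp
  | cons i l ih =>
    simp only [tupleCode, List.map_cons, List.flatMap_cons] at h
    obtain ⟨h1, h2⟩ := List.append_inj h (by simp [List.length_flatMap, hxy])
    obtain ⟨h3, -⟩ := List.append_inj h1 (by simp [List.length_flatMap, hxy])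
    intro j hj
    rcases List.mem_cons.1 hj with rfl | hj
    · exact flatMap_double_injective h3
    · exact ih h2 j hj

theorem eq_of_tupleCode_subtuple_eq {m : ℕ} {x y : Fin m → List Bool}
    (hxy : ∀ i, (x i).length = (y i).length) {I : Finset (Fin m)}
    (h : tupleCode (subtuple x I) = tupleCode (subtuple y I)) : ∀ i ∈ I, x i = y i :=
  fun i hi => eq_of_tupleCode_map_eq hxy h i (by simpa using hi)

theorem tupleCode_subtuple_congr {m : ℕ} {x y : Fin m → List Bool} {I : Finset (Fin m)}
    (h : ∀ i ∈ I, x i = y i) : tupleCode (subtuple x I) = tupleCode (subtuple y I) := by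
  unfold subtuple
  congr 1
  exact List.map_congr_left fun i hi => h i (by simpa using hi)

/-- The number of binary digits of `n + 1`, which specifying `n` costs in a program, is
`O(log n)`. -/
theorem size_succ_le (n : ℕ) (hn : 2 ≤ n) : ((n + 1).size : ℝ) ≤ 3 + 2 * Real.log n := by
  obtain ⟨k, hk⟩ : ∃ k, (n + 1).size = k + 1 :=
    Nat.exists_eq_succ_of_ne_zero (Nat.size_pos.2 (Nat.succ_pos n)).ne'
  have h1 : 2 ^ k ≤ n + 1 := Nat.lt_size.1 (by omega)
  have hn0 : (2 : ℝ) ≤ n := by exact_mod_cast hn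
  have h2 : (2 : ℝ) ^ k ≤ 2 * n := by
    have : (2 : ℝ) ^ k ≤ n + 1 := by exact_mod_cast h1
    linarith
  have h3 := Real.log_le_log (by positivity) h2
  rw [Real.log_pow, Real.log_mul (by norm_num) (by linarith)] at h3
  have h4 := Real.log_two_gt_d9
  have h5 : 0 ≤ Real.log n := Real.log_nonneg (by linarith)
  rw [hk]
  push_cast
  have hk0 : (0 : ℝ) ≤ k := k.cast_nonneg
  by_contra! h
  nlinarith [Real.log_two_lt_d9]

theorem eventually_add_mul_log_lt {κ : ℝ} (hκ : 0 < κ) (a b : ℝ) :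
    ∀ᶠ n : ℕ in Filter.atTop, a + b * Real.log n < κ * n := by
  have h1 : (fun x : ℝ => a + b * Real.log x) =o[Filter.atTop] (id : ℝ → ℝ) :=
    (Asymptotics.isLittleO_const_id_atTop a).add (Real.isLittleO_log_id_atTop.const_mul_left b)
  have h2 := (h1.bound (half_pos hκ)).and (Filter.eventually_gt_atTop 0)
  filter_upwards [tendsto_natCast_atTop_atTop.eventually h2] with n hn
  have := (le_abs_self _).trans hn.1
  rw [id, Real.norm_of_nonneg hn.2.le] at this
  nlinarith [hn.2]

/-- The combinatorial form of a complexity inequality: a finite set of tuples whose projections to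
the coordinates in `J` have at most `2 ^ (n * p J / N)` elements is split into parts, whose
projections to the coordinates in `I` have at most `2 ^ (n * w I / N)` elements. -/
theorem exists_splitting_finset {D : List Bool →. List Bool} (hD : IsOptimal D) {m : ℕ}
    {𝓘 𝓙 : Finset (Finset (Fin m))} {lam mu : Finset (Fin m) → ℝ}
    (hlam : ∀ I ∈ 𝓘, 0 < lam I) (hmu : ∀ J ∈ 𝓙, 0 < mu J)
    (hineq : ComplexityInequality D 𝓘 𝓙 lam mu) {N : ℕ} (hN : 0 < N) (w p : Finset (Fin m) → ℕ)
    (hwp : ∑ J ∈ 𝓙, mu J * p J < ∑ I ∈ 𝓘, lam I * w I) :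
    ∃ n₀, ∀ n ≥ n₀, ∀ A : Finset (Fin m → List Bool), (∀ x ∈ A, ∀ i, (x i).length = n) →
      (∀ J ∈ 𝓙, (A.image fun x => tupleCode (subtuple x J)).card ≤ 2 ^ (n * p J / N)) →
      ∃ B : Finset (Fin m) → Finset (List Bool), (∀ I ∈ 𝓘, (B I).card ≤ 2 ^ (n * w I / N)) ∧
        ∀ x ∈ A, ∃ I ∈ 𝓘, tupleCode (subtuple x I) ∈ B I := by
  classical
  let e := 𝓘.equivFin.symm
  let f := 𝓙.equivFin.symm
  have hdiv : ∀ k : ℕ, Primrec fun n : ℕ => n * k / N := fun k =>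
    Primrec.nat_div.comp (Primrec.nat_mul.comp Primrec.id (Primrec.const k)) (Primrec.const N)
  have hpow : ∀ {g : ℕ → ℕ}, Primrec g → Primrec fun n => 2 ^ g n := fun hg =>
    primrec₂_pow.comp (Primrec.const 2) hg
  obtain ⟨C₁, hC₁⟩ := exists_simple_uncoverable hD
    (φ := fun i x => tupleCode (subtuple x (e i : Finset (Fin m))))
    (ψ := fun j x => tupleCode (subtuple x (f j : Finset (Fin m))))
    (M := fun i n => 2 ^ (n * w (e i) / N)) (U := fun n => 2 ^ (n * (∑ I ∈ 𝓘, w I) / N))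
    (v := fun j n => n * p (f j) / N) (V := fun n x => ∀ i, (x i).length = n)
    (fun i => primrec_tupleCode_subtuple _) (fun j => primrec_tupleCode_subtuple _)
    (fun i => hpow (hdiv _)) (hpow (hdiv _))
    (fun i n => Nat.pow_le_pow_right (by norm_num) (Nat.div_le_div_right (Nat.mul_le_mul_left _
      (Finset.single_le_sum (f := w) (fun _ _ => Nat.zero_le _) (e i).2))))
    (fun j => hdiv _)
    (fun j a b hab => Nat.div_le_div_right (Nat.mul_le_mul_right _ hab))
    (primrecPred_forall_fin fun i => Primrec.eq.comp (Primrec.list_length.comp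
      (Primrec.fin_app.comp Primrec.snd (Primrec.const i))) Primrec.fst)
  obtain ⟨C₂, hC₂⟩ := hineq
  have hN' : (0 : ℝ) < N := by exact_mod_cast hN
  obtain ⟨n₁, hn₁⟩ := Filter.eventually_atTop.1 (eventually_add_mul_log_lt
    (κ := (∑ I ∈ 𝓘, lam I * w I - ∑ J ∈ 𝓙, mu J * p J) / N) (div_pos (sub_pos.2 hwp) hN')
    (∑ I ∈ 𝓘, lam I + (∑ J ∈ 𝓙, mu J) * (3 + C₁)) ((∑ J ∈ 𝓙, mu J) * 2 + C₂))
  refine ⟨max n₁ 2, fun n hn A hAn hAp => ?_⟩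
  have hn2 : 2 ≤ n := (le_max_right _ _).trans hn
  have hbig := hn₁ n ((le_max_left _ _).trans hn)
  have hcov : Coverable (fun i x => tupleCode (subtuple x (e i : Finset (Fin m))))
      (fun i => 2 ^ (n * w (e i) / N)) (A : Set (Fin m → List Bool)) := by
    by_contra hnot
    obtain ⟨A', hA'n, hA', hA'K⟩ := hC₁ n A hAn (fun j => hAp _ (f j).2) hnot
    refine hA' ?_
    choose B hBc hB using hD.exists_finset_complexity_lt
    refine ⟨fun i => B (n * w (e i) / N), fun i => hBc _, fun x hx => ?_⟩
    by_contra! hlarge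
    have h1 := hC₂ n hn2 x (hA'n x hx)
    have h2 : ∑ I ∈ 𝓘, lam I * (n * w I / N - 1 : ℝ) ≤
        ∑ I ∈ 𝓘, lam I * (tupleComplexity D x I : ℝ) := by
      refine Finset.sum_le_sum fun I hI => mul_le_mul_of_nonneg_left ?_ (hlam I hI).le
      have h3 : n * w I / N ≤ tupleComplexity D x I := by
        by_contra! hlt
        refine hlarge (𝓘.equivFin ⟨I, hI⟩) (hB _ _ ?_)
        simpa [e, tupleComplexity] using hlt
      have h4 : (n * w I / N : ℝ) < (n * w I / N : ℕ) + 1 := by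
        rw [div_lt_iff₀ hN']
        have := Nat.lt_div_mul_add (a := n * w I) hN
        have h5 : ((n * w I : ℕ) : ℝ) < ((n * w I / N * N + N : ℕ) : ℝ) := by exact_mod_cast this
        push_cast at h5
        linarith
      have h5 : ((n * w I / N : ℕ) : ℝ) ≤ tupleComplexity D x I := by exact_mod_cast h3
      linarith
    have h3 : ∑ J ∈ 𝓙, mu J * (tupleComplexity D x J : ℝ) ≤
        ∑ J ∈ 𝓙, mu J * (n * p J / N + (3 + 2 * Real.log n + C₁) : ℝ) := by
      refine Finset.sum_le_sum fun J hJ => mul_le_mul_of_nonneg_left ?_ (hmu J hJ).le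
      have h4 := hA'K x hx (𝓙.equivFin ⟨J, hJ⟩)
      simp only [f, Equiv.symm_apply_apply] at h4
      have h5 : (tupleComplexity D x J : ℝ) ≤ (n * p J / N : ℕ) + (n + 1).size + C₁ := by
        exact_mod_cast h4
      have h6 : ((n * p J / N : ℕ) : ℝ) ≤ n * p J / N := by
        simpa using Nat.cast_div_le (α := ℝ) (m := n * p J) (n := N)
      have := size_succ_le n hn2
      linarith
    have h4 : ∑ I ∈ 𝓘, lam I * (n * w I / N - 1 : ℝ) =
        n / N * ∑ I ∈ 𝓘, lam I * w I - ∑ I ∈ 𝓘, lam I := by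
      rw [Finset.mul_sum, ← Finset.sum_sub_distrib]
      exact Finset.sum_congr rfl fun _ _ => by ring
    have h5 : ∑ J ∈ 𝓙, mu J * (n * p J / N + (3 + 2 * Real.log n + C₁) : ℝ) =
        n / N * ∑ J ∈ 𝓙, mu J * p J + (∑ J ∈ 𝓙, mu J) * (3 + 2 * Real.log n + C₁) := by
      rw [Finset.mul_sum, Finset.sum_mul, ← Finset.sum_add_distrib]
      exact Finset.sum_congr rfl fun _ _ => by ring
    rw [sub_div, sub_mul] at hbig
    have h6 : ∀ s : ℝ, s / N * n = n / N * s := fun s => by ring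
    rw [h6, h6] at hbig
    rw [h4] at h2
    rw [h5] at h3
    linarith
  obtain ⟨B, hB, hAB⟩ := hcov
  refine ⟨fun I => if hI : I ∈ 𝓘 then B (𝓘.equivFin ⟨I, hI⟩) else ∅, fun I hI => ?_,
    fun x hx => ?_⟩
  · simpa [hI, e] using hB (𝓘.equivFin ⟨I, hI⟩)
  · obtain ⟨i, hi⟩ := hAB x hx
    exact ⟨e i, (e i).2, by simpa [e] using hi⟩

/-! ### Dyadic cells and their codes -/

/-- The index of the half-open dyadic cube of side `2⁻ⁿ` that contains `x`. -/
noncomputable def dyadicCell {ι : Type*} (n : ℕ) (x : EuclideanSpace ℝ ι) : ι → ℤ :=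
  fun i => ⌊2 ^ n * x i⌋

/-- The first `n` binary digits of the fractional part of `t`. -/
noncomputable def dyadicBits (n : ℕ) (t : ℝ) : List Bool :=
  List.ofFn fun i : Fin n => decide (⌊(2 : ℝ) ^ (i + 1 : ℕ) * t⌋ % 2 = 1)

@[simp]
theorem length_dyadicBits (n : ℕ) (t : ℝ) : (dyadicBits n t).length = n := by
  simp [dyadicBits]

theorem floor_pow_mul_div_two (n : ℕ) (t : ℝ) :
    ⌊(2 : ℝ) ^ (n + 1) * t⌋ / 2 = ⌊(2 : ℝ) ^ n * t⌋ := by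
  have h := Int.floor_div_natCast ((2 : ℝ) ^ (n + 1) * t) 2
  rw [pow_succ] at h ⊢
  rw [show (2 : ℝ) ^ n * 2 * t / (2 : ℕ) = 2 ^ n * t by push_cast; ring] at h
  exact_mod_cast h.symm

theorem floor_eq_of_dyadicBits_eq {n : ℕ} {s t : ℝ} (h0 : ⌊s⌋ = ⌊t⌋)
    (h : dyadicBits n s = dyadicBits n t) : ⌊(2 : ℝ) ^ n * s⌋ = ⌊(2 : ℝ) ^ n * t⌋ := by
  have h1 : ∀ i < n, (⌊(2 : ℝ) ^ (i + 1) * s⌋ % 2 = 1 ↔ ⌊(2 : ℝ) ^ (i + 1) * t⌋ % 2 = 1) := by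
    intro i hi
    simpa using congrFun (List.ofFn_injective h) ⟨i, hi⟩
  clear h
  induction n with
  | zero => simpa using h0
  | succ n ih =>
    have h2 := ih fun i hi => h1 i (by omega)
    have h3 := h1 n (by omega)
    have h4 := floor_pow_mul_div_two n s
    have h5 := floor_pow_mul_div_two n t
    omega

theorem floor_eq_of_le {k n : ℕ} (hk : k ≤ n) {s t : ℝ}
    (h : ⌊(2 : ℝ) ^ n * s⌋ = ⌊(2 : ℝ) ^ n * t⌋) : ⌊(2 : ℝ) ^ k * s⌋ = ⌊(2 : ℝ) ^ k * t⌋ := by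
  induction n, hk using Nat.le_induction with
  | base => exact h
  | succ n _ ih =>
    exact ih (by rw [← floor_pow_mul_div_two, h, floor_pow_mul_div_two])

theorem dyadicBits_congr {n : ℕ} {s t : ℝ} (h : ⌊(2 : ℝ) ^ n * s⌋ = ⌊(2 : ℝ) ^ n * t⌋) :
    dyadicBits n s = dyadicBits n t := by
  unfold dyadicBits
  congr 1
  ext i
  rw [floor_eq_of_le (Nat.succ_le_of_lt i.2) h]

theorem abs_sub_le_of_floor_eq {n : ℕ} {s t : ℝ}
    (h : ⌊(2 : ℝ) ^ n * s⌋ = ⌊(2 : ℝ) ^ n * t⌋) : |s - t| ≤ (2 ^ n)⁻¹ := by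
  have h1 := (Int.abs_sub_lt_one_of_floor_eq_floor h).le
  rw [← mul_sub, abs_mul, abs_of_pos (by positivity : (0 : ℝ) < 2 ^ n)] at h1
  rwa [← one_div, le_div_iff₀' (by positivity)]

theorem abs_apply_sub_le_dist {ι : Type*} [Fintype ι] (x y : EuclideanSpace ℝ ι) (i : ι) :
    |x i - y i| ≤ dist x y := by
  rw [dist_eq_norm]
  exact PiLp.norm_apply_le (x - y) i

/-! ### Packing dimension and box counting -/

/-- If the packing sums of exponent `s` of `E` are at most `1`, then `E` meets `O(2 ^ (n * s))` dyadic
cubes of side `2⁻ⁿ`. The cubes are divided into `4 ^ card ι` classes by their indices modulo `4`;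
points of different cubes of one class are more than `2 * 2⁻ⁿ` apart, and so are centres of a
packing. -/
theorem card_dyadicCell_le {ι : Type*} [Fintype ι] {E : Set (EuclideanSpace ℝ ι)} {s : ℝ≥0}
    {δ : ℝ} (hE : packingSup s δ E ≤ 1) {n : ℕ} (hn : ((2 : ℝ) ^ n)⁻¹ ≤ δ) (G : Finset (ι → ℤ))
    (hG : (G : Set (ι → ℤ)) ⊆ dyadicCell n '' E) :
    (G.card : ℝ) ≤ 4 ^ Fintype.card ι * 2 ^ (n * s : ℝ) := by
  classical
  set ρ : ℝ := (2 ^ n)⁻¹ with hρ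
  have hρ0 : 0 < ρ := by positivity
  choose! pt hptE hpt using fun g (hg : g ∈ G) => hG (Finset.mem_coe.2 hg)
  let κ : (ι → ℤ) → ι → ZMod 4 := fun g i => g i
  have hfib : ∀ b : ι → ZMod 4, ((G.filter fun g => κ g = b).card : ℝ) ≤ 2 ^ (n * s : ℝ) := by
    intro b
    set H := G.filter fun g => κ g = b
    have hHG : ∀ g ∈ H, g ∈ G := fun g hg => (Finset.mem_filter.1 hg).1
    have hinj : Set.InjOn (fun g => (pt g, ρ)) (H : Set (ι → ℤ)) := fun g hg g' hg' h => by
      rw [← hpt g (hHG g hg), ← hpt g' (hHG g' hg'), show pt g = pt g' from (Prod.ext_iff.1 h).1]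
    let P : Finset (EuclideanSpace ℝ ι × ℝ) := H.image fun g => (pt g, ρ)
    have hP : IsPacking E δ (P : Set (EuclideanSpace ℝ ι × ℝ)) := by
      refine ⟨P.countable_toSet, fun p hp => ?_, fun p hp p' hp' hne => ?_⟩
      · obtain ⟨g, hg, rfl⟩ := Finset.mem_image.1 (Finset.mem_coe.1 hp)
        exact ⟨hptE g (hHG g hg), hρ0, hn⟩
      · obtain ⟨g, hg, rfl⟩ := Finset.mem_image.1 (Finset.mem_coe.1 hp)
        obtain ⟨g', hg', rfl⟩ := Finset.mem_image.1 (Finset.mem_coe.1 hp')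
        have hgg' : g ≠ g' := by rintro rfl; exact hne rfl
        obtain ⟨i, hi⟩ := Function.ne_iff.1 hgg'
        have hmod : (g i : ZMod 4) = g' i :=
          congrFun ((Finset.mem_filter.1 hg).2.trans (Finset.mem_filter.1 hg').2.symm) i
        have hdvd : (4 : ℤ) ∣ g i - g' i := by
          exact_mod_cast (ZMod.intCast_eq_intCast_iff_dvd_sub (g' i) (g i) 4).1 hmod.symm
        have h4 : (4 : ℝ) ≤ |(g i : ℝ) - g' i| := by
          have := Int.le_of_dvd (abs_pos.2 (sub_ne_zero.2 hi)) ((dvd_abs _ _).2 hdvd)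
          exact_mod_cast this
        refine Metric.closedBall_disjoint_closedBall ?_
        -- Both coordinates are rounded down to indices that differ by at least `4`.
        have h1 : (3 : ℝ) ≤ 2 ^ n * |pt g i - pt g' i| := by
          have e1 : ⌊2 ^ n * pt g i⌋ = g i := congrFun (hpt g (hHG g hg)) i
          have e2 : ⌊2 ^ n * pt g' i⌋ = g' i := congrFun (hpt g' (hHG g' hg')) i
          rw [← abs_of_pos (by positivity : (0 : ℝ) < 2 ^ n), ← abs_mul, mul_sub]
          have f1 := Int.floor_le (2 ^ n * pt g i)
          have f2 := Int.floor_le (2 ^ n * pt g' i)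
          have f3 := Int.lt_floor_add_one (2 ^ n * pt g i)
          have f4 := Int.lt_floor_add_one (2 ^ n * pt g' i)
          rw [e1] at f1 f3
          rw [e2] at f2 f4
          rcases le_abs.1 h4 with h | h
          · exact le_abs.2 (Or.inl (by linarith))
          · exact le_abs.2 (Or.inr (by linarith))
        have h2 := abs_apply_sub_le_dist (pt g) (pt g') i
        have h3 : 3 * ρ ≤ |pt g i - pt g' i| := by
          rw [hρ, mul_inv_le_iff₀ (by positivity), mul_comm]
          exact h1
        change ρ + ρ < dist (pt g) (pt g')
        linarith
    have hsum : (H.card : ℝ≥0∞) * ENNReal.ofReal (2 * ρ) ^ (s : ℝ) ≤ 1 := by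
      refine le_trans (le_of_eq ?_) ((le_iSup₂ (f := fun (P : Set (EuclideanSpace ℝ ι × ℝ))
        (_ : IsPacking E δ P) => ∑' p : P, ENNReal.ofReal (2 * p.1.2) ^ (s : ℝ)) _ hP).trans hE)
      rw [Finset.tsum_subtype' P fun p => ENNReal.ofReal (2 * p.2) ^ (s : ℝ),
        Finset.sum_image hinj]
      simp
    rw [ENNReal.ofReal_rpow_of_pos (by positivity), ← ENNReal.ofReal_natCast,
      ← ENNReal.ofReal_mul (by positivity), ENNReal.ofReal_le_one] at hsum
    have h1 : ((2 : ℝ) ^ (n * s : ℝ))⁻¹ ≤ (2 * ρ) ^ (s : ℝ) := by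
      rw [Real.rpow_mul (by norm_num), Real.rpow_natCast, ← Real.inv_rpow (by positivity)]
      exact Real.rpow_le_rpow (by positivity) (by linarith) s.2
    have h2 : (H.card : ℝ) * ((2 : ℝ) ^ (n * s : ℝ))⁻¹ ≤ 1 :=
      (mul_le_mul_of_nonneg_left h1 (by positivity)).trans hsum
    rwa [mul_inv_le_iff₀ (by positivity), one_mul] at h2
  calc (G.card : ℝ) = ∑ b : ι → ZMod 4, ((G.filter fun g => κ g = b).card : ℝ) := by
        exact_mod_cast Finset.card_eq_sum_card_fiberwise fun g _ =>
          Finset.mem_coe.2 (Finset.mem_univ _)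
    _ ≤ ∑ b : ι → ZMod 4, (2 : ℝ) ^ (n * s : ℝ) := Finset.sum_le_sum fun b _ => hfib b
    _ = 4 ^ Fintype.card ι * 2 ^ (n * s : ℝ) := by simp [ZMod.card]

/-- A set of packing dimension less than `d` is a countable union of sets with bounded packing sums
of an exponent less than `d`. -/
theorem exists_packingSup_le_one {X : Type*} [PseudoMetricSpace X] {E : Set X} {d : ℝ≥0∞}
    (h : dimP E < d) :
    ∃ (s : ℝ≥0) (F : ℕ → Set X) (δ : ℕ → ℝ), (s : ℝ≥0∞) < d ∧ E ⊆ ⋃ k, F k ∧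
      ∀ k, 0 < δ k ∧ packingSup s (δ k) (F k) ≤ 1 := by
  obtain ⟨s, hs0, hs⟩ : ∃ s : ℝ≥0, packingMeasure s E = 0 ∧ (s : ℝ≥0∞) < d := by
    simpa [dimP, iInf_lt_iff] using h
  obtain ⟨F, hEF, hF⟩ : ∃ F : ℕ → Set X, E ⊆ ⋃ k, F k ∧
      ∑' k, packingPremeasure s (F k) < 1 := by
    have : packingMeasure s E < 1 := by rw [hs0]; exact one_pos
    simpa [packingMeasure, iInf_lt_iff] using this
  have hδ : ∀ k, ∃ δ : ℝ, 0 < δ ∧ packingSup s δ (F k) < 1 := fun k => by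
    have := (ENNReal.le_tsum k).trans_lt hF
    simpa [packingPremeasure, iInf_lt_iff] using this
  choose δ hδ0 hδ using hδ
  exact ⟨s, F, δ, hs, hEF, fun k => ⟨hδ0 k, (hδ k).le⟩⟩

/-! ### Hausdorff dimension of upper limits of sets -/

/-- If every point of `Y` belongs for infinitely many `n` to one of at most `2 ^ (n * a)` sets of
diameter `O(2⁻ⁿ)`, then the Hausdorff dimension is at most `a`. The sets are the fibres of
`code n` over `B n`. -/
theorem dimH_image_le_of_frequently {X Z γ : Type*} [MetricSpace X] {Y : Set Z} {π : Z → X}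
    {code : ℕ → Z → γ} {B : ℕ → Finset γ} {a K : ℝ} (ha : 0 ≤ a)
    (hB : ∀ᶠ n in Filter.atTop, ((B n).card : ℝ) ≤ 2 ^ (n * a : ℝ))
    (hK : ∀ n, ∀ x ∈ Y, ∀ y ∈ Y, code n x = code n y → dist (π x) (π y) ≤ K * (2 ^ n)⁻¹)
    (hY : ∀ x ∈ Y, ∃ᶠ n in Filter.atTop, code n x ∈ B n) :
    dimH (π '' Y) ≤ ENNReal.ofReal a := by
  classical
  borelize X
  refine le_of_forall_gt_imp_ge_of_dense fun t' ht' => ?_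
  obtain ⟨t, hat, htt'⟩ := ENNReal.lt_iff_exists_nnreal_btwn.1 ht'
  refine le_trans (dimH_le_of_hausdorffMeasure_ne_top ?_) htt'.le
  have hat' : a < t := by
    rw [← ENNReal.ofReal_coe_nnreal] at hat
    exact (ENNReal.ofReal_lt_ofReal_iff_of_nonneg ha).1 hat
  have ht0 : (0 : ℝ) ≤ t := t.2
  set L : ℝ := max K 0
  have hL0 : 0 ≤ L := le_max_right _ _
  let cov : ∀ k : ℕ, (Σ j : ℕ, B (k + j)) → Set X := fun k i =>
    π '' {x ∈ Y | code (k + i.1) x = i.2}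
  have hdiam : ∀ k i, Metric.ediam (cov k i) ≤ ENNReal.ofReal (L * (2 ^ (k + i.1))⁻¹) := by
    rintro k ⟨j, b⟩
    refine Metric.ediam_le ?_
    rintro _ ⟨x, ⟨hx, hxb⟩, rfl⟩ _ ⟨y, ⟨hy, hyb⟩, rfl⟩
    rw [edist_dist]
    refine ENNReal.ofReal_le_ofReal ((hK _ x hx y hy (hxb.trans hyb.symm)).trans ?_)
    exact mul_le_mul_of_nonneg_right (le_max_left _ _) (by positivity)
  set Q : ℝ := 2 ^ (a - t)
  have hQ0 : 0 < Q := by positivity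
  have hQ1 : Q < 1 := Real.rpow_lt_one_of_one_lt_of_neg (by norm_num) (by linarith)
  -- The covers by the sets of all levels from `k` on have bounded sums of exponent `t`.
  have hsum : ∀ᶠ k in Filter.atTop, ∑' i, Metric.ediam (cov k i) ^ (t : ℝ) ≤
      ENNReal.ofReal (L ^ (t : ℝ)) * (1 - ENNReal.ofReal Q)⁻¹ := by
    obtain ⟨n₀, hn₀⟩ := Filter.eventually_atTop.1 hB
    filter_upwards [Filter.eventually_ge_atTop n₀] with k hk
    rw [ENNReal.tsum_sigma', ← ENNReal.tsum_geometric, ← ENNReal.tsum_mul_left]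
    refine ENNReal.tsum_le_tsum fun j => ?_
    calc ∑' b : B (k + j), Metric.ediam (cov k ⟨j, b⟩) ^ (t : ℝ)
        ≤ ∑' b : B (k + j), ENNReal.ofReal (L * (2 ^ (k + j))⁻¹) ^ (t : ℝ) :=
          ENNReal.tsum_le_tsum fun b => ENNReal.rpow_le_rpow (hdiam k ⟨j, b⟩) ht0
      _ = ENNReal.ofReal ((B (k + j)).card * (L * (2 ^ (k + j))⁻¹) ^ (t : ℝ)) := by
          rw [tsum_fintype, Finset.sum_const, nsmul_eq_mul,
            ENNReal.ofReal_rpow_of_nonneg (by positivity) ht0, ENNReal.ofReal_mul (by positivity)]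
          simp
      _ ≤ ENNReal.ofReal (L ^ (t : ℝ) * Q ^ j) := by
          refine ENNReal.ofReal_le_ofReal ?_
          have h1 := hn₀ (k + j) (by omega)
          have h2 : (L * ((2 : ℝ) ^ (k + j))⁻¹) ^ (t : ℝ) =
              L ^ (t : ℝ) * 2 ^ (-((k + j : ℕ) * t) : ℝ) := by
            rw [Real.mul_rpow hL0 (by positivity), Real.rpow_neg (by norm_num),
              Real.inv_rpow (by positivity), Real.rpow_mul (by norm_num), Real.rpow_natCast]
          have h3 : (2 : ℝ) ^ ((k + j : ℕ) * a : ℝ) * 2 ^ (-((k + j : ℕ) * t) : ℝ) =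
              Q ^ (k + j) := by
            rw [← Real.rpow_add (by norm_num), ← Real.rpow_natCast, ← Real.rpow_mul (by norm_num)]
            congr 1; ring
          have h4 : Q ^ (k + j) ≤ Q ^ j := pow_le_pow_of_le_one hQ0.le hQ1.le (by omega)
          calc _ ≤ (2 : ℝ) ^ ((k + j : ℕ) * a : ℝ) * (L * (2 ^ (k + j))⁻¹) ^ (t : ℝ) :=
                mul_le_mul_of_nonneg_right h1 (by positivity)
            _ = L ^ (t : ℝ) * Q ^ (k + j) := by rw [h2, ← h3]; ring
            _ ≤ _ := mul_le_mul_of_nonneg_left h4 (by positivity)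
      _ = ENNReal.ofReal (L ^ (t : ℝ)) * ENNReal.ofReal Q ^ j := by
          rw [ENNReal.ofReal_mul (by positivity), ENNReal.ofReal_pow hQ0.le]
  have hr : Filter.Tendsto (fun k : ℕ => ENNReal.ofReal (L * (2 ^ k)⁻¹)) Filter.atTop
      (nhds 0) := by
    have h1 : Filter.Tendsto (fun k : ℕ => L * ((2 : ℝ) ^ k)⁻¹) Filter.atTop (nhds (L * 0)) := by
      refine Filter.Tendsto.const_mul _ ?_
      simpa using tendsto_pow_atTop_nhds_zero_of_lt_one (r := (2 : ℝ)⁻¹) (by norm_num) (by norm_num)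
    simpa using ENNReal.tendsto_ofReal h1
  have hμ := MeasureTheory.Measure.hausdorffMeasure_le_liminf_tsum (t : ℝ) (π '' Y)
    (fun k : ℕ => ENNReal.ofReal (L * (2 ^ k)⁻¹)) hr cov
    (Filter.Eventually.of_forall fun k i => (hdiam k i).trans (ENNReal.ofReal_le_ofReal
      (mul_le_mul_of_nonneg_left (inv_anti₀ (by positivity)
        (pow_le_pow_right₀ (by norm_num) (by omega))) hL0)))
    (Filter.Eventually.of_forall fun k => by
      rintro _ ⟨x, hx, rfl⟩
      obtain ⟨n, hn, hxn⟩ := Filter.frequently_atTop.1 (hY x hx) k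
      obtain ⟨j, rfl⟩ := Nat.exists_eq_add_of_le hn
      exact Set.mem_iUnion.2 ⟨⟨j, code (k + j) x, hxn⟩, x, ⟨hx, rfl⟩, rfl⟩)
  refine ne_top_of_le_ne_top ?_ (hμ.trans
    ((Filter.liminf_le_liminf hsum).trans (Filter.liminf_const _).le))
  refine ENNReal.mul_ne_top ENNReal.ofReal_ne_top (ENNReal.inv_ne_top.2 ?_)
  exact (tsub_pos_of_lt (ENNReal.ofReal_lt_one.2 hQ1)).ne'

/-! ### From finite splittings to a splitting of a set of real tuples -/

/-- The tuple of the first `n` binary digits of the fractional parts of the coordinates of `x`. -/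
noncomputable def dyadicTuple {m : ℕ} (n : ℕ) (x : EuclideanSpace ℝ (Fin m)) :
    Fin m → List Bool :=
  fun i => dyadicBits n (x i)

theorem dist_proj_le {m : ℕ} {I : Finset (Fin m)} {n : ℕ} {x y : EuclideanSpace ℝ (Fin m)}
    (h0 : ∀ i, ⌊x i⌋ = ⌊y i⌋)
    (h : tupleCode (subtuple (dyadicTuple n x) I) = tupleCode (subtuple (dyadicTuple n y) I)) :
    dist (proj I x) (proj I y) ≤ √(I.card) * (2 ^ n)⁻¹ := by
  have h1 := eq_of_tupleCode_subtuple_eq (fun i => by simp [dyadicTuple]) h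
  rw [EuclideanSpace.dist_eq, ← Real.sqrt_sq (by positivity : (0 : ℝ) ≤ (2 ^ n)⁻¹),
    ← Real.sqrt_mul (by positivity)]
  refine Real.sqrt_le_sqrt ((Finset.sum_le_card_nsmul _ _ (((2 : ℝ) ^ n)⁻¹ ^ 2)
    fun i _ => ?_).trans (by simp))
  refine pow_le_pow_left₀ dist_nonneg ?_ 2
  exact abs_sub_le_of_floor_eq (floor_eq_of_dyadicBits_eq (h0 i) (h1 i i.2))

theorem eventually_le_pow_div {s : ℝ} {p N : ℕ} (hN : 0 < N) (hs : s < p / N) (d : ℕ) :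
    ∀ᶠ n : ℕ in Filter.atTop, (4 : ℝ) ^ d * 2 ^ (n * s : ℝ) ≤ 2 ^ (n * p / N) := by
  have hN' : (0 : ℝ) < N := by exact_mod_cast hN
  have h := tendsto_natCast_atTop_atTop (R := ℝ) |>.const_mul_atTop (sub_pos.2 hs)
  filter_upwards [h.eventually_ge_atTop (2 * d + 1)] with n hn
  have h4 : (n * p / N : ℝ) < (n * p / N : ℕ) + 1 := by
    rw [div_lt_iff₀ hN']
    have := Nat.lt_div_mul_add (a := n * p) hN
    have h5 : ((n * p : ℕ) : ℝ) < ((n * p / N * N + N : ℕ) : ℝ) := by exact_mod_cast this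
    push_cast at h5
    linarith
  have h6 : (4 : ℝ) ^ d = 2 ^ (2 * d : ℝ) := by
    rw [Real.rpow_mul (by norm_num), Real.rpow_natCast]; norm_num
  rw [h6, ← Real.rpow_add (by norm_num), ← Real.rpow_natCast]
  refine Real.rpow_le_rpow_of_exponent_le (by norm_num) ?_
  have h7 : (n * p / N : ℝ) = p / N * n := by ring
  rw [h7] at h4
  linarith

theorem eventually_card_codes_le {m : ℕ} {J : Finset (Fin m)} {F : Set (EuclideanSpace ℝ J)}
    {s : ℝ≥0} {δ : ℝ} (hδ : 0 < δ) (hF : packingSup s δ F ≤ 1) {p N : ℕ} (hN : 0 < N)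
    (hs : (s : ℝ) < p / N) :
    ∀ᶠ n in Filter.atTop, ∀ A : Finset (Fin m → List Bool),
      (∀ c ∈ A, ∃ x, proj J x ∈ F ∧ c = dyadicTuple n x) →
      (A.image fun c => tupleCode (subtuple c J)).card ≤ 2 ^ (n * p / N) := by
  classical
  have h1 : ∀ᶠ n : ℕ in Filter.atTop, ((2 : ℝ) ^ n)⁻¹ ≤ δ := by
    have := tendsto_pow_atTop_nhds_zero_of_lt_one (r := (2 : ℝ)⁻¹) (by norm_num) (by norm_num)
    filter_upwards [this.eventually (ge_mem_nhds hδ)] with n hn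
    simpa using hn
  filter_upwards [h1, eventually_le_pow_div hN hs (Fintype.card J)] with n hn hle A hA
  have h2 : ∀ b ∈ A.image fun c => tupleCode (subtuple c J), ∃ x, proj J x ∈ F ∧
      b = tupleCode (subtuple (dyadicTuple n x) J) := by
    intro b hb
    obtain ⟨c, hc, rfl⟩ := Finset.mem_image.1 hb
    obtain ⟨x, hx, rfl⟩ := hA c hc
    exact ⟨x, hx, rfl⟩
  choose! x hxF hx using h2
  have hinj : Set.InjOn (fun b => dyadicCell n (proj J (x b)))
      (A.image fun c => tupleCode (subtuple c J) : Finset (List Bool)) := by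
    intro b hb b' hb' h
    rw [hx b hb, hx b' hb']
    exact tupleCode_subtuple_congr fun i hi => dyadicBits_congr (congrFun h ⟨i, hi⟩)
  have h3 := card_dyadicCell_le hF hn
    ((A.image fun c => tupleCode (subtuple c J)).image fun b => dyadicCell n (proj J (x b))) (by
      rintro _ hg
      obtain ⟨b, hb, rfl⟩ := Finset.mem_image.1 (Finset.mem_coe.1 hg)
      exact ⟨_, hxF b hb, rfl⟩)
  rw [Finset.card_image_of_injOn hinj] at h3
  exact_mod_cast h3.trans hle

/-- A splitting of `S` with rational bounds on the dimensions, for a strict inequality between the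
bounds. -/
theorem exists_splitting_of_lt {D : List Bool →. List Bool} (hD : IsOptimal D) {m : ℕ}
    {𝓘 𝓙 : Finset (Finset (Fin m))} {lam mu : Finset (Fin m) → ℝ}
    (hlam : ∀ I ∈ 𝓘, 0 < lam I) (hmu : ∀ J ∈ 𝓙, 0 < mu J)
    (hineq : ComplexityInequality D 𝓘 𝓙 lam mu) {N : ℕ} (hN : 0 < N) (w p : Finset (Fin m) → ℕ)
    (hwp : ∑ J ∈ 𝓙, mu J * p J < ∑ I ∈ 𝓘, lam I * w I) {S : Set (EuclideanSpace ℝ (Fin m))}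
    (hS : ∀ J ∈ 𝓙, dimP (proj J '' S) < ENNReal.ofReal (p J / N)) :
    ∃ T : Finset (Fin m) → Set (EuclideanSpace ℝ (Fin m)),
      (∀ I, T I ⊆ S) ∧ (∀ x ∈ S, ∃ I ∈ 𝓘, x ∈ T I) ∧
      ∀ I ∈ 𝓘, dimH (proj I '' T I) ≤ ENNReal.ofReal (w I / N) := by
  classical
  choose! s F δ hs hF hδ using fun J hJ => exists_packingSup_le_one (hS J hJ)
  have hN' : (0 : ℝ) < N := by exact_mod_cast hN
  have hs' : ∀ J ∈ 𝓙, (s J : ℝ) < p J / N := fun J hJ => by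
    have := hs J hJ
    rw [← ENNReal.ofReal_coe_nnreal] at this
    exact (ENNReal.ofReal_lt_ofReal_iff_of_nonneg (s J).2).1 this
  -- Countably many pieces: the integer parts of the coordinates are fixed, and each projection
  -- lies in a set with bounded packing sums.
  let Y : (Fin m → ℤ) × (Finset (Fin m) → ℕ) → Set (EuclideanSpace ℝ (Fin m)) := fun κ =>
    {x | x ∈ S ∧ (∀ i, ⌊x i⌋ = κ.1 i) ∧ ∀ J ∈ 𝓙, proj J x ∈ F J (κ.2 J)}
  have hcode : ∀ κ n, {c | ∃ x ∈ Y κ, dyadicTuple n x = c}.Finite := fun κ n => by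
    refine (Set.Finite.pi' fun _ : Fin m => List.finite_length_eq Bool n).subset ?_
    rintro _ ⟨x, -, rfl⟩ i
    simp [dyadicTuple]
  have hpiece : ∀ κ, ∃ B : ℕ → Finset (Fin m) → Finset (List Bool), ∀ᶠ n in Filter.atTop,
      (∀ I ∈ 𝓘, (B n I).card ≤ 2 ^ (n * w I / N)) ∧
        ∀ x ∈ Y κ, ∃ I ∈ 𝓘, tupleCode (subtuple (dyadicTuple n x) I) ∈ B n I := by
    intro κ
    obtain ⟨n₀, hn₀⟩ := exists_splitting_finset hD hlam hmu hineq hN w p hwp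
    have h1 : ∀ᶠ n in Filter.atTop, ∀ J ∈ 𝓙,
        ((hcode κ n).toFinset.image fun c => tupleCode (subtuple c J)).card ≤
          2 ^ (n * p J / N) := by
      rw [Filter.eventually_all_finset]
      intro J hJ
      obtain ⟨hδ0, hδ1⟩ := hδ J hJ (κ.2 J)
      filter_upwards [eventually_card_codes_le hδ0 hδ1 hN (hs' J hJ)] with n hn
      refine hn _ fun c hc => ?_
      obtain ⟨x, hx, rfl⟩ := (hcode κ n).mem_toFinset.1 hc
      exact ⟨x, hx.2.2 J hJ, rfl⟩
    have h2 : ∀ᶠ n in Filter.atTop, ∃ B : Finset (Fin m) → Finset (List Bool),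
        (∀ I ∈ 𝓘, (B I).card ≤ 2 ^ (n * w I / N)) ∧
          ∀ x ∈ Y κ, ∃ I ∈ 𝓘, tupleCode (subtuple (dyadicTuple n x) I) ∈ B I := by
      filter_upwards [h1, Filter.eventually_ge_atTop n₀] with n hn hn0
      obtain ⟨B, hB, hcov⟩ := hn₀ n hn0 (hcode κ n).toFinset (fun c hc i => by
        obtain ⟨x, -, rfl⟩ := (hcode κ n).mem_toFinset.1 hc
        simp [dyadicTuple]) hn
      exact ⟨B, hB, fun x hx => hcov _ ((hcode κ n).mem_toFinset.2 ⟨x, hx, rfl⟩)⟩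
    exact h2.choice
  choose B hB using hpiece
  let T : (Fin m → ℤ) × (Finset (Fin m) → ℕ) → Finset (Fin m) →
      Set (EuclideanSpace ℝ (Fin m)) := fun κ I =>
    {x ∈ Y κ | ∃ᶠ n in Filter.atTop, tupleCode (subtuple (dyadicTuple n x) I) ∈ B κ n I}
  refine ⟨fun I => ⋃ κ, T κ I, fun I => Set.iUnion_subset fun κ x hx => hx.1.1, fun x hx => ?_,
    fun I hI => ?_⟩
  · have hk : ∀ J, ∃ k, J ∈ 𝓙 → proj J x ∈ F J k := fun J => by
      by_cases hJ : J ∈ 𝓙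
      · obtain ⟨k, hk⟩ := Set.mem_iUnion.1 (hF J hJ (Set.mem_image_of_mem _ hx))
        exact ⟨k, fun _ => hk⟩
      · exact ⟨0, fun h => (hJ h).elim⟩
    choose k hk using hk
    have hxY : x ∈ Y (fun i => ⌊x i⌋, k) := ⟨hx, fun _ => rfl, hk⟩
    have hfreq : ∃ I ∈ 𝓘, ∃ᶠ n in Filter.atTop,
        tupleCode (subtuple (dyadicTuple n x) I) ∈ B (fun i => ⌊x i⌋, k) n I := by
      by_contra! h
      have h2 := (Filter.eventually_all_finset 𝓘).2 h
      obtain ⟨n, hn, -, hn'⟩ := (h2.and (hB (fun i => ⌊x i⌋, k))).exists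
      obtain ⟨I, hI, hxI⟩ := hn' x hxY
      exact hn I hI hxI
    obtain ⟨I, hI, hxI⟩ := hfreq
    exact ⟨I, hI, Set.mem_iUnion.2 ⟨_, hxY, hxI⟩⟩
  · rw [Set.image_iUnion, dimH_iUnion]
    refine iSup_le fun κ => ?_
    refine dimH_image_le_of_frequently (K := √(I.card)) (B := fun n => B κ n I)
      (code := fun n x => tupleCode (subtuple (dyadicTuple n x) I)) (by positivity) ?_
      (fun n x hx y hy h => dist_proj_le
        (fun i => (hx.1.2.1 i).trans (hy.1.2.1 i).symm) h) fun x hx => hx.2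
    filter_upwards [hB κ] with n hn
    have h1 : ((B κ n I).card : ℝ) ≤ 2 ^ (n * w I / N) := by exact_mod_cast hn.1 I hI
    refine h1.trans ?_
    rw [← Real.rpow_natCast]
    refine Real.rpow_le_rpow_of_exponent_le (by norm_num) ?_
    have := Nat.cast_div_le (α := ℝ) (m := n * w I) (n := N)
    push_cast at this
    rwa [mul_div_assoc] at this

end KolmDim

theorem mainTheorem1 (D : List Bool →. List Bool) (hD : KolmDim.IsOptimal D)
    (m : ℕ) (𝓘 𝓙 : Finset (Finset (Fin m)))
    (h𝓘 : ∀ I ∈ 𝓘, I.Nonempty) (h𝓙 : ∀ J ∈ 𝓙, J.Nonempty)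
    (hdisj : Disjoint 𝓘 𝓙) (h𝓘ne : 𝓘.Nonempty)
    (lam mu : Finset (Fin m) → ℝ)
    (hlam : ∀ I ∈ 𝓘, 0 < lam I) (hmu : ∀ J ∈ 𝓙, 0 < mu J)
    (hineq : KolmDim.ComplexityInequality D 𝓘 𝓙 lam mu)
    (S : Set (EuclideanSpace ℝ (Fin m)))
    (a : Finset (Fin m) → ℝ) (ha : ∀ I ∈ 𝓘, 0 ≤ a I)
    (hdim : ∑ J ∈ 𝓙, ENNReal.ofReal (mu J) * KolmDim.dimP (KolmDim.proj J '' S) ≤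
      ENNReal.ofReal (∑ I ∈ 𝓘, lam I * a I)) :
    ∃ T : Finset (Fin m) → Set (EuclideanSpace ℝ (Fin m)),
      S = ⋃ I ∈ 𝓘, T I ∧
      ∀ I ∈ 𝓘, dimH (KolmDim.proj I '' T I) ≤ ENNReal.ofReal (a I) := by
  classical
  have hla : 0 ≤ ∑ I ∈ 𝓘, lam I * a I :=
    Finset.sum_nonneg fun I hI => mul_nonneg (hlam I hI).le (ha I hI)
  have hfin : ∀ J ∈ 𝓙, KolmDim.dimP (KolmDim.proj J '' S) ≠ ⊤ := fun J hJ htop => by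
    have h1 := (Finset.single_le_sum (f := fun J => ENNReal.ofReal (mu J) *
      KolmDim.dimP (KolmDim.proj J '' S)) (fun _ _ => bot_le) hJ).trans hdim
    rw [htop, ENNReal.mul_top (ENNReal.ofReal_pos.2 (hmu J hJ)).ne', top_le_iff] at h1
    exact ENNReal.ofReal_ne_top h1
  let d : Finset (Fin m) → ℝ := fun J => (KolmDim.dimP (KolmDim.proj J '' S)).toReal
  have hd0 : ∀ J, 0 ≤ d J := fun J => ENNReal.toReal_nonneg
  have hdd : ∀ J ∈ 𝓙, ENNReal.ofReal (d J) = KolmDim.dimP (KolmDim.proj J '' S) := fun J hJ =>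
    ENNReal.ofReal_toReal (hfin J hJ)
  have hsum : ∑ J ∈ 𝓙, mu J * d J ≤ ∑ I ∈ 𝓘, lam I * a I := by
    rw [← ENNReal.ofReal_le_ofReal_iff hla,
      ENNReal.ofReal_sum_of_nonneg fun J hJ => mul_nonneg (hmu J hJ).le (hd0 J)]
    refine le_trans (Finset.sum_le_sum fun J hJ => ?_) hdim
    rw [ENNReal.ofReal_mul (hmu J hJ).le, hdd J hJ]
  have hlam0 : 0 < ∑ I ∈ 𝓘, lam I := Finset.sum_pos hlam h𝓘ne
  -- Rounding up the dimensions `d J` to multiples of `1 / N` costs at most `(∑ mu J) / N`, which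
  -- `h` steps of `1 / N` in each of the bounds `a I` outweigh.
  obtain ⟨h, hh⟩ := exists_nat_gt ((∑ J ∈ 𝓙, mu J) / ∑ I ∈ 𝓘, lam I)
  rw [div_lt_iff₀ hlam0] at hh
  let w : ℕ → Finset (Fin m) → ℕ := fun N I => ⌊N * a I⌋₊ + 1 + h
  let p : ℕ → Finset (Fin m) → ℕ := fun N J => ⌊N * d J⌋₊ + 1
  have happrox : ∀ N : ℕ, 0 < N → ∃ T : Finset (Fin m) → Set (EuclideanSpace ℝ (Fin m)),
      (∀ I, T I ⊆ S) ∧ (∀ x ∈ S, ∃ I ∈ 𝓘, x ∈ T I) ∧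
      ∀ I ∈ 𝓘, dimH (KolmDim.proj I '' T I) ≤ ENNReal.ofReal (w N I / N) := by
    intro N hN
    have hN' : (0 : ℝ) < N := by exact_mod_cast hN
    refine KolmDim.exists_splitting_of_lt hD hlam hmu hineq hN (w N) (p N) ?_ fun J hJ => ?_
    · calc ∑ J ∈ 𝓙, mu J * (p N J : ℝ) ≤ ∑ J ∈ 𝓙, (N * (mu J * d J) + mu J) := by
            refine Finset.sum_le_sum fun J hJ => ?_
            have := Nat.floor_le (mul_nonneg hN'.le (hd0 J))
            simp only [p]
            push_cast
            nlinarith [hmu J hJ]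
        _ = N * ∑ J ∈ 𝓙, mu J * d J + ∑ J ∈ 𝓙, mu J := by
            rw [Finset.sum_add_distrib, Finset.mul_sum]
        _ < N * ∑ I ∈ 𝓘, lam I * a I + h * ∑ I ∈ 𝓘, lam I :=
            add_lt_add_of_le_of_lt (mul_le_mul_of_nonneg_left hsum hN'.le) hh
        _ = ∑ I ∈ 𝓘, (N * (lam I * a I) + h * lam I) := by
            rw [Finset.sum_add_distrib, Finset.mul_sum, Finset.mul_sum]
        _ ≤ ∑ I ∈ 𝓘, lam I * (w N I : ℝ) := by
            refine Finset.sum_le_sum fun I hI => ?_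
            have := Nat.lt_floor_add_one (N * a I)
            simp only [w]
            push_cast
            nlinarith [hlam I hI]
    · rw [← hdd J hJ, ENNReal.ofReal_lt_ofReal_iff_of_nonneg (hd0 J), lt_div_iff₀ hN', mul_comm]
      simpa [p] using Nat.lt_floor_add_one (N * d J)
  choose T hTS hcov hT using fun k : ℕ => happrox (k + 1) k.succ_pos
  -- A point belongs to the part `I` if it belongs to the approximate part `I` infinitely often.
  refine ⟨fun I => {x | ∃ᶠ k in Filter.atTop, x ∈ T k I}, ?_, fun I hI => ?_⟩
  · refine Set.Subset.antisymm (fun x hx => ?_)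
      (Set.iUnion₂_subset fun I _ x hx => hTS _ _ hx.exists.choose_spec)
    by_contra hnot
    simp only [Set.mem_iUnion, Set.mem_ofPred_eq, exists_prop, not_exists, not_and,
      Filter.not_frequently] at hnot
    obtain ⟨k, hk⟩ := ((Filter.eventually_all_finset 𝓘).2 hnot).exists
    obtain ⟨I, hI, hxI⟩ := hcov k x hx
    exact hk I hI hxI
  · have hlim : Filter.Tendsto (fun k : ℕ => ENNReal.ofReal (a I + (1 + h) * (1 / ((k : ℝ) + 1))))
        Filter.atTop (nhds (ENNReal.ofReal (a I))) := by
      refine ENNReal.tendsto_ofReal ?_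
      simpa using (tendsto_one_div_add_atTop_nhds_zero_nat (𝕜 := ℝ)).const_mul (1 + (h : ℝ))
        |>.const_add (a I)
    refine ge_of_tendsto hlim (Filter.Eventually.of_forall fun k => ?_)
    have hsub : KolmDim.proj I '' {x | ∃ᶠ k in Filter.atTop, x ∈ T k I} ⊆
        ⋃ j, KolmDim.proj I '' T (k + j) I := by
      rintro _ ⟨x, hx, rfl⟩
      obtain ⟨l, hl, hxl⟩ := Filter.frequently_atTop.1 hx k
      obtain ⟨j, rfl⟩ := Nat.exists_eq_add_of_le hl
      exact Set.mem_iUnion.2 ⟨j, x, hxl, rfl⟩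
    refine (dimH_mono hsub).trans ?_
    rw [dimH_iUnion]
    refine iSup_le fun j => (hT (k + j) I hI).trans (ENNReal.ofReal_le_ofReal ?_)
    have h1 := Nat.floor_le (mul_nonneg (Nat.cast_nonneg (k + j + 1)) (ha I hI))
    have hk : (0 : ℝ) < (k + j + 1 : ℕ) := by positivity
    calc (w (k + j + 1) I : ℝ) / (k + j + 1 : ℕ)
        ≤ ((k + j + 1 : ℕ) * a I + (1 + h)) / (k + j + 1 : ℕ) := by
          refine div_le_div_of_nonneg_right ?_ hk.le
          simp only [w]
          push_cast at h1 ⊢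
          linarith
      _ = a I + (1 + h) * (1 / (k + j + 1 : ℕ)) := by field_simp
      _ ≤ a I + (1 + h) * (1 / ((k : ℝ) + 1)) := by
          gcongr
          push_cast
          linarith [(Nat.cast_nonneg j : (0 : ℝ) ≤ j)]
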